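/- Let $n \ge 0$ be an integer and let $G$ be one of the groups \[ SO(n)=\{B\in\mathbb R^{n\times n} : B^{T}B=I,\ \det B=1\},\qquad U(n)=\{B\in\mathbb C^{n\times n} : B^{*}B=I\}, \] regarded as an embedded real-analytic submanifold of the ambient matrix space, with Lie algebra $\mathfrak g$ equal to \[ \mathfrak{so}(n)=\{A\in\mathbb R^{n\times n} : A+A^{T}=0\},\qquad \mathfrak{u}(n)=\{A\in\mathbb C^{n\times n} : A+A^{*}=0\}, \] respectively, regarded as a real normed space with the norm coming from $\langle X,Y\rangle=\operatorname{tr}(X^{*}Y)$. Then there is a bounded open neighbourhood $V\subset\mathfrak g$ of $0$ such that the matrix exponential $\exp(A)=\sum_{k\ge 0}A^k/k!$ maps $V$ into $G$, is real-analytic and injective on $V$, its image $\exp(V)$ is open in $G$, and the inverse map $\exp(V)\to V$ is real-analytic (that is, near each point of $\exp(V)$ it is the restriction of a real-analytic map defined on an open set of matrices). Moreover, the whole group $G$ lies in the closure of $\exp(V)$. -/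

import Mathlib

open scoped Matrix.Norms.Frobenius

/-- The Lie algebra `𝔰𝔬(n)`: real matrices with `A + Aᵀ = 0`, as a real vector space
(normed by the Frobenius norm of the ambient matrix space). -/
noncomputable abbrev soAlgebra (n : ℕ) : Submodule ℝ (Matrix (Fin n) (Fin n) ℝ) :=
  skewAdjoint.submodule ℝ (Matrix (Fin n) (Fin n) ℝ)

/-- The Lie algebra `𝔲(n)`: complex matrices with `A + Aᴴ = 0`, as a real vector space
(normed by the Frobenius norm of the ambient matrix space). -/
noncomputable abbrev uAlgebra (n : ℕ) : Submodule ℝ (Matrix (Fin n) (Fin n) ℂ) :=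
  skewAdjoint.submodule ℝ (Matrix (Fin n) (Fin n) ℂ)

theorem mem_soAlgebra_iff {n : ℕ} (A : Matrix (Fin n) (Fin n) ℝ) :
    A ∈ soAlgebra n ↔ A + A.transpose = 0 := by
  rw [add_comm, add_eq_zero_iff_eq_neg, ← Matrix.conjTranspose_eq_transpose_of_trivial]
  exact skewAdjoint.mem_iff

theorem mem_uAlgebra_iff {n : ℕ} (A : Matrix (Fin n) (Fin n) ℂ) :
    A ∈ uAlgebra n ↔ A + A.conjTranspose = 0 := by
  rw [add_comm, add_eq_zero_iff_eq_neg]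
  exact skewAdjoint.mem_iff

/-- The map `φ` from the normed space `𝔤` to the embedded real-analytic submanifold `G` of the
normed space `E` is bi-analytic on `V`: it maps `V` into `G` and is analytic on `V`, the image
`φ(V)` is open in `G`, and `φ` is invertible on `V` with inverse `L : φ(V) → 𝔤` analytic.

Analyticity of `L` on the open subset `φ(V)` of the submanifold `G` is expressed by
`AnalyticOn`: around each point of `φ(V)`, the map `L` agrees on `φ(V)` with the sum of a convergent
power series on the ambient space `E`; that is, `L` is locally the restriction of an analytic
map defined on an open subset of `E`. The values of `L` outside `φ(V)` are irrelevant. -/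
structure IsBianalyticOn {𝔤 E : Type*} [NormedAddCommGroup 𝔤] [NormedSpace ℝ 𝔤]
    [NormedAddCommGroup E] [NormedSpace ℝ E] (φ : 𝔤 → E) (G : Set E) (V : Set 𝔤) : Prop where
  mapsTo : Set.MapsTo φ V G
  analytic : AnalyticOnNhd ℝ φ V
  isOpen_image : ∃ O : Set E, IsOpen O ∧ φ '' V = O ∩ G
  analytic_inverse : ∃ L : E → 𝔤, Set.LeftInvOn L φ V ∧ AnalyticOn ℝ L (φ '' V)

/-!
In both cases `V` consists of the skew-adjoint matrices `A` whose operator norm on the complex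
Euclidean space is less than `π`, that is, whose eigenvalues `iθ` satisfy `|θ| < π`. On the
skew-adjoint elements of norm less than `π` in a C⋆-algebra, `exp` is injective, with inverse the
principal logarithm `logUnitary`, and its image consists of the unitary elements `u` with
`‖u - 1‖ < 2`, that is, of those without `-1` in the spectrum. This condition is open, and a real
matrix that satisfies it has a real logarithm, because the logarithm is unique and so invariant
under complex conjugation (`logUnitary_mem_range_realMatrixToEuclideanCLM`).

For analyticity of the inverse (`analyticOn_logUnitary`) the inverse function theorem is applied
to `exp` on the whole algebra. It needs the derivative `D` of `exp` at `A ∈ V` to be injective.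
Differentiating `x * exp x = exp x * x` shows that `D h = 0` makes `h` commute with `exp A`, hence
with `A`, which is a function of `exp A`; but then `D h = exp A * h`, so `h = 0`
(`injective_fderiv_exp`). The logarithm, being continuous, coincides near `exp A` with the analytic
local inverse so obtained.

For density, every `B` in the group has to be approximated in the group by matrices `C` with
`det (1 + C) ≠ 0`. It is enough to join `B` to one such matrix by an analytic curve in the group,
since a nonzero analytic function of one variable has isolated zeros
(`mem_closure_of_analytic_curve`). In `U(n)` the curve `t ↦ exp (i t) • B` will do. A matrix in
`SO(n)` is a product of an even number of reflections, by the Cartan–Dieudonné theorem, and a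
product of two reflections is joined to the identity by moving one mirror vector to the other along
a line (`joinedToOneAnalytically_reflectionMatrix_mul`).
-/

/-! ### The derivative of the exponential -/

section BanachAlgebra

variable {𝔸 : Type*} [NormedRing 𝔸] [NormedAlgebra ℝ 𝔸] [CompleteSpace 𝔸]

/-- Differentiate the identity `x * exp x = exp x * x` at `a` in the direction `h`. -/
theorem commute_exp_of_fderiv_exp_eq_zero {a h : 𝔸}
    (h0 : fderiv ℝ (NormedSpace.exp : 𝔸 → 𝔸) a h = 0) : Commute h (NormedSpace.exp a) := by
  have hd : HasFDerivAt (NormedSpace.exp : 𝔸 → 𝔸) (fderiv ℝ NormedSpace.exp a) a :=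
    (NormedSpace.exp_analytic (𝕂 := ℝ) a).differentiableAt.hasFDerivAt
  have h1 := hd.mul' (hasFDerivAt_id a)
  have h2 := (hasFDerivAt_id (𝕜 := ℝ) a).mul' hd
  have he : (id * NormedSpace.exp : 𝔸 → 𝔸) = NormedSpace.exp * id := by
    funext x
    exact ((Commute.refl x).exp_right).eq
  rw [he] at h2
  have h3 := congrArg (fun T : 𝔸 →L[ℝ] 𝔸 => T h) (h1.unique h2)
  simpa [h0, Commute, SemiconjBy, eq_comm] using h3

theorem fderiv_exp_apply_of_commute {a h : 𝔸} (hc : Commute a h) :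
    fderiv ℝ (NormedSpace.exp : 𝔸 → 𝔸) a h = NormedSpace.exp a * h := by
  let +nondep : NormedAlgebra ℚ 𝔸 := .restrictScalars ℚ ℝ 𝔸
  have hd : HasFDerivAt (NormedSpace.exp : 𝔸 → 𝔸) (fderiv ℝ NormedSpace.exp a) a :=
    (NormedSpace.exp_analytic (𝕂 := ℝ) a).differentiableAt.hasFDerivAt
  have h1 : HasDerivAt (fun t : ℝ => NormedSpace.exp (a + t • h))
      (fderiv ℝ (NormedSpace.exp : 𝔸 → 𝔸) a h) 0 := by
    have hl : HasDerivAt (fun t : ℝ => a + t • h) h 0 := by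
      simpa using ((hasDerivAt_id (0 : ℝ)).smul_const h).const_add a
    have hd' : HasFDerivAt (NormedSpace.exp : 𝔸 → 𝔸) (fderiv ℝ NormedSpace.exp a)
        (a + (0 : ℝ) • h) := by simpa using hd
    exact hd'.comp_hasDerivAt (0 : ℝ) hl
  have h2 : HasDerivAt (fun t : ℝ => NormedSpace.exp a * NormedSpace.exp (t • h))
      (NormedSpace.exp a * h) 0 := by
    simpa using (hasDerivAt_exp_smul_const (𝕂 := ℝ) h 0).const_mul (NormedSpace.exp a)
  refine h1.unique (h2.congr_of_eventuallyEq (.of_forall fun t => ?_))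
  exact NormedSpace.exp_add_of_commute (hc.smul_right t)

/-- If the derivative of `exp` at `a` kills `h`, then `h` commutes with `exp a`. Where this forces
`h` to commute with `a`, the derivative takes `h` to `exp a * h`, and `exp a` is invertible. -/
theorem injective_fderiv_exp {a : 𝔸} (ha : ∀ h, Commute h (NormedSpace.exp a) → Commute h a) :
    Function.Injective (fderiv ℝ (NormedSpace.exp : 𝔸 → 𝔸) a) := by
  let +nondep : NormedAlgebra ℚ 𝔸 := .restrictScalars ℚ ℝ 𝔸
  refine (injective_iff_map_eq_zero _).2 fun h h0 => ?_
  have hc := ha h (commute_exp_of_fderiv_exp_eq_zero h0)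
  rw [fderiv_exp_apply_of_commute hc.symm] at h0
  exact (NormedSpace.isUnit_exp a).mul_right_eq_zero.1 h0

/-- The inverse function theorem for the exponential of a finite-dimensional algebra. -/
theorem exists_analyticAt_leftInverse_exp [FiniteDimensional ℝ 𝔸] {a : 𝔸}
    (ha : ∀ h, Commute h (NormedSpace.exp a) → Commute h a) :
    ∃ g : 𝔸 → 𝔸, AnalyticAt ℝ g (NormedSpace.exp a) ∧
      ∀ᶠ x in nhds a, g (NormedSpace.exp x) = x := by
  have han : AnalyticAt ℝ (NormedSpace.exp : 𝔸 → 𝔸) a := NormedSpace.exp_analytic a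
  let i : 𝔸 ≃L[ℝ] 𝔸 := (LinearEquiv.ofInjectiveEndo
    (fderiv ℝ (NormedSpace.exp : 𝔸 → 𝔸) a : 𝔸 →ₗ[ℝ] 𝔸)
    (injective_fderiv_exp ha)).toContinuousLinearEquiv
  have hi : fderiv ℝ (NormedSpace.exp : 𝔸 → 𝔸) a = i := by ext; rfl
  have hs : HasStrictFDerivAt (NormedSpace.exp : 𝔸 → 𝔸) (i : 𝔸 →L[ℝ] 𝔸) a :=
    hi ▸ han.hasStrictFDerivAt
  refine ⟨hs.localInverse _ _ _, ?_, hs.eventually_left_inverse⟩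
  exact (hs.toOpenPartialHomeomorph _).analyticAt_symm' hs.mem_toOpenPartialHomeomorph_source
    han hi

end BanachAlgebra

/-! ### The principal logarithm of a unitary element -/

section CStarAlgebra

open Complex Unitary selfAdjoint
open scoped Real

variable {𝒜 : Type*} [CStarAlgebra 𝒜]

/-- The principal logarithm of a unitary element `u` of a C⋆-algebra with `‖u - 1‖ < 2`: `I` times
its argument, in the sense of the continuous functional calculus. For other `u` the value has no meaning. -/
noncomputable def logUnitary (u : 𝒜) : 𝒜 :=
  I • cfc (fun z => (arg z : ℂ)) u

theorem logUnitary_mem_skewAdjoint (u : 𝒜) : logUnitary u ∈ skewAdjoint 𝒜 :=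
  (IsSelfAdjoint.cfc_arg u).smul_mem_skewAdjoint conj_I

theorem norm_logUnitary_lt_pi {u : 𝒜} (hu : u ∈ unitary 𝒜) (h2 : ‖u - 1‖ < 2) :
    ‖logUnitary u‖ < π := by
  have := (Unitary.openPartialHomeomorph (A := 𝒜)).map_source (x := ⟨u, hu⟩)
    (by simpa [Subtype.dist_eq, dist_eq_norm] using h2)
  simpa [logUnitary, norm_smul, Subtype.dist_eq, dist_eq_norm] using this

theorem exp_logUnitary {u : 𝒜} (hu : u ∈ unitary 𝒜) (h2 : ‖u - 1‖ < 2) :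
    NormedSpace.exp (logUnitary u) = u :=
  congrArg Subtype.val (expUnitary_argSelfAdjoint (u := ⟨u, hu⟩) h2)

theorem exists_eq_I_smul_of_mem_skewAdjoint {x : 𝒜} (hx : x ∈ skewAdjoint 𝒜) :
    ∃ y : selfAdjoint 𝒜, x = I • (y : 𝒜) := by
  refine ⟨⟨(-I) • x, ?_⟩, ?_⟩
  · simp [selfAdjoint.mem_iff, skewAdjoint.mem_iff.1 hx]
  · simp [smul_smul]

theorem logUnitary_exp {x : 𝒜} (hx : x ∈ skewAdjoint 𝒜) (hπ : ‖x‖ < π) :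
    logUnitary (NormedSpace.exp x) = x := by
  obtain ⟨y, rfl⟩ := exists_eq_I_smul_of_mem_skewAdjoint hx
  have h := congrArg Subtype.val (argSelfAdjoint_expUnitary (x := y) (by simpa [norm_smul] using hπ))
  exact congrArg (I • ·) h

theorem norm_exp_sub_one_lt_two {x : 𝒜} (hx : x ∈ skewAdjoint 𝒜) (hπ : ‖x‖ < π) :
    ‖NormedSpace.exp x - 1‖ < 2 := by
  obtain ⟨y, rfl⟩ := exists_eq_I_smul_of_mem_skewAdjoint hx
  have := (Unitary.openPartialHomeomorph (A := 𝒜)).map_target (x := y)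
    (by simpa [norm_smul] using hπ)
  simpa [Subtype.dist_eq, dist_eq_norm] using this

theorem continuousOn_logUnitary :
    ContinuousOn (logUnitary : 𝒜 → 𝒜) {u | u ∈ unitary 𝒜 ∧ ‖u - 1‖ < 2} := by
  have h := (continuous_subtype_val.comp_continuousOn
    (Unitary.continuousOn_argSelfAdjoint (A := 𝒜))).const_smul I
  have h' : ContinuousOn (fun u : unitary 𝒜 => logUnitary (u : 𝒜)) (Metric.ball 1 2) := h
  rw [continuousOn_iff_continuous_domRestrict] at h' ⊢
  exact h'.comp (f := fun u : {u : 𝒜 | u ∈ unitary 𝒜 ∧ ‖u - 1‖ < 2} =>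
    (⟨⟨u.1, u.2.1⟩, by simpa [Subtype.dist_eq, dist_eq_norm] using u.2.2⟩ :
      Metric.ball (1 : unitary 𝒜) 2)) (by fun_prop)

/-- `x` is a function of `exp x`, so it commutes with whatever commutes with `exp x`. -/
theorem commute_of_commute_exp {x h : 𝒜} (hx : x ∈ skewAdjoint 𝒜) (hπ : ‖x‖ < π)
    (hc : Commute h (NormedSpace.exp x)) : Commute h x := by
  let +nondep : NormedAlgebra ℚ 𝒜 := .restrictScalars ℚ ℂ 𝒜
  have hs : star (NormedSpace.exp x) = NormedSpace.exp (-x) := by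
    rw [NormedSpace.star_exp, skewAdjoint.mem_iff.1 hx]
  have hc' : Commute (star (NormedSpace.exp x)) h := by
    let _ := NormedSpace.invertibleExp x
    rw [hs, ← NormedSpace.invOf_exp]
    exact hc.symm.invOf_left
  rw [← logUnitary_exp hx hπ]
  exact ((hc.symm.cfc hc' _).smul_left I).symm

/-- The principal logarithm agrees, near each point `exp x` of its domain, with an analytic map
defined on all of the algebra, namely with a local inverse of `exp`. -/
theorem analyticOn_logUnitary [FiniteDimensional ℝ 𝒜] :
    AnalyticOn ℝ (logUnitary : 𝒜 → 𝒜) {u | u ∈ unitary 𝒜 ∧ ‖u - 1‖ < 2} := by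
  rintro u ⟨hu, h2⟩
  have hπ := norm_logUnitary_lt_pi hu h2
  obtain ⟨g, hg, hgl⟩ := exists_analyticAt_leftInverse_exp (a := logUnitary u)
    fun h => commute_of_commute_exp (logUnitary_mem_skewAdjoint u) hπ
  rw [exp_logUnitary hu h2] at hg
  refine hg.analyticWithinAt.congr_of_eventuallyEq ?_ ?_
  · filter_upwards [(continuousOn_logUnitary u ⟨hu, h2⟩).eventually hgl, self_mem_nhdsWithin]
      with v hv hv'
    rw [← hv, exp_logUnitary hv'.1 hv'.2]
  · rw [← hgl.self_of_nhds, exp_logUnitary hu h2]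

end CStarAlgebra

/-! ### Density of the matrices without eigenvalue `-1` -/

section AnalyticCurve

variable {𝕜 : Type*} [RCLike 𝕜] {n : ℕ}

theorem Matrix.analyticOnNhd_det :
    AnalyticOnNhd ℝ (Matrix.det : Matrix (Fin n) (Fin n) 𝕜 → 𝕜) Set.univ := by
  intro A _
  have he : ∀ i j, AnalyticAt ℝ (fun B : Matrix (Fin n) (Fin n) 𝕜 => B i j) A := fun i j =>
    (Matrix.entryLinearMap ℝ 𝕜 i j).toContinuousLinearMap.analyticAt A
  have : (Matrix.det : Matrix (Fin n) (Fin n) 𝕜 → 𝕜) = fun B =>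
      ∑ σ : Equiv.Perm (Fin n), ((Equiv.Perm.sign σ : ℤ) : 𝕜) * ∏ i, B (σ i) i :=
    funext fun B => Matrix.det_apply' B
  rw [this]
  exact Finset.analyticAt_fun_sum _ fun σ _ =>
    analyticAt_const.mul (Finset.analyticAt_fun_prod _ fun i _ => he _ _)

/-- Along an analytic curve the condition `det (1 + γ t) ≠ 0` can only fail at isolated times,
unless it fails at all times. -/
theorem mem_closure_of_analytic_curve {G : Set (Matrix (Fin n) (Fin n) 𝕜)}
    {γ : ℝ → Matrix (Fin n) (Fin n) 𝕜} (hγ : AnalyticOnNhd ℝ γ Set.univ) (hG : ∀ t, γ t ∈ G)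
    {t₁ : ℝ} (h₁ : (1 + γ t₁).det ≠ 0) (t₀ : ℝ) :
    γ t₀ ∈ closure {C ∈ G | (1 + C).det ≠ 0} := by
  have hf : AnalyticOnNhd ℝ (fun t => (1 + γ t).det) Set.univ := fun t _ =>
    AnalyticAt.fun_comp (Matrix.analyticOnNhd_det (1 + γ t) trivial)
      (analyticAt_const.fun_add (hγ t trivial))
  have hev : ∀ᶠ t in nhdsWithin t₀ {t₀}ᶜ, (1 + γ t).det ≠ 0 := by
    by_contra hcon
    have hcon' : ∃ᶠ t in nhdsWithin t₀ {t₀}ᶜ, (1 + γ t).det = 0 := hcon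
    exact h₁ (hf.eqOn_zero_of_preconnected_of_frequently_eq_zero isPreconnected_univ
      (Set.mem_univ t₀) hcon' (Set.mem_univ t₁))
  refine mem_closure_of_tendsto (b := nhdsWithin t₀ {t₀}ᶜ)
    ((hγ t₀ trivial).continuousAt.tendsto.mono_left nhdsWithin_le_nhds) ?_
  filter_upwards [hev] with t ht using ⟨hG t, ht⟩

end AnalyticCurve

/-- Multiply by a scalar moving on the unit circle. -/
theorem Matrix.unitaryGroup_subset_closure_det_ne_zero (n : ℕ) :
    (Matrix.unitaryGroup (Fin n) ℂ : Set (Matrix (Fin n) (Fin n) ℂ)) ⊆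
      closure {C ∈ (Matrix.unitaryGroup (Fin n) ℂ : Set (Matrix (Fin n) (Fin n) ℂ)) |
        (1 + C).det ≠ 0} := by
  intro B hB
  let γ : ℝ → Matrix (Fin n) (Fin n) ℂ := fun t => Complex.exp (t * Complex.I) • B
  have hγ : AnalyticOnNhd ℝ γ Set.univ := by
    intro t _
    have : AnalyticAt ℝ (fun t : ℝ => Complex.exp (t * Complex.I)) t :=
      AnalyticAt.fun_comp (analyticAt_cexp.restrictScalars)
        ((Complex.ofRealCLM.analyticAt t).mul analyticAt_const)
    exact this.smul analyticAt_const
  have hG : ∀ t, γ t ∈ Matrix.unitaryGroup (Fin n) ℂ := by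
    intro t
    have hB := Matrix.mem_unitaryGroup_iff.1 hB
    rw [Matrix.mem_unitaryGroup_iff]
    simp only [γ, star_smul, Matrix.smul_mul, Matrix.mul_smul, hB, smul_smul]
    rw [Complex.star_def, ← Complex.exp_conj, ← Complex.exp_add]
    simp
  -- the circle is infinite, so some point of it is not an eigenvalue of `-B`
  obtain ⟨z, hz, hz'⟩ : ∃ z ∈ Metric.sphere (0 : ℂ) 1, z ∉ ((-B).charpoly.rootSet ℂ) := by
    have hinf : (Metric.sphere (0 : ℂ) 1).Infinite :=
      (isPreconnected_sphere (by simp [Complex.rank_real_complex]) 0 1).infinite_of_nontrivial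
        ⟨1, by simp, -1, by simp, by norm_num⟩
    exact (hinf.sdiff (Polynomial.rootSet_finite _ _)).nonempty
  obtain ⟨θ, hθ⟩ : ∃ θ : ℝ, Complex.exp (θ * Complex.I) = z := by
    refine ⟨z.arg, ?_⟩
    have := Complex.norm_mul_exp_arg_mul_I z
    simpa [mem_sphere_zero_iff_norm.1 hz] using this
  have h₁ : (1 + γ (-θ)).det ≠ 0 := by
    intro h0
    apply hz'
    rw [Polynomial.mem_rootSet']
    refine ⟨by simpa using (Matrix.charpoly_monic (-B)).ne_zero, ?_⟩
    rw [Polynomial.coe_aeval_eq_eval, Matrix.eval_charpoly]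
    have : Matrix.scalar (Fin n) z - -B = z • (1 + γ (-θ)) := by
      simp only [γ, smul_add, smul_smul, ← hθ, ← Complex.exp_add]
      simp [Matrix.smul_one_eq_diagonal]
    rw [this, Matrix.det_smul, h0, mul_zero]
  have := mem_closure_of_analytic_curve hγ hG h₁ 0
  simpa [γ] using this

/-! ### Rotations as products of reflections -/

/-- The matrix of the reflection of `ℝⁿ` in the hyperplane orthogonal to `w`; for `w = 0` it is
the identity. -/
noncomputable def reflectionMatrix {n : ℕ} (w : Fin n → ℝ) : Matrix (Fin n) (Fin n) ℝ :=
  1 - (2 / (w ⬝ᵥ w)) • Matrix.vecMulVec w w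

section Reflections

open Matrix

variable {n : ℕ}

theorem reflectionMatrix_smul {c : ℝ} (hc : c ≠ 0) (w : Fin n → ℝ) :
    reflectionMatrix (c • w) = reflectionMatrix w := by
  simp only [reflectionMatrix, smul_dotProduct, dotProduct_smul, vecMulVec_smul, smul_vecMulVec,
    smul_smul, smul_eq_mul]
  congr 2
  by_cases hw : w ⬝ᵥ w = 0
  · simp [hw]
  · field_simp

theorem reflectionMatrix_mul_self {w : Fin n → ℝ} (hw : w ≠ 0) :
    reflectionMatrix w * reflectionMatrix w = 1 := by
  have h : w ⬝ᵥ w ≠ 0 := by simpa using hw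
  simp only [reflectionMatrix, mul_sub, sub_mul, mul_one, one_mul, Matrix.smul_mul,
    Matrix.mul_smul, vecMulVec_mul_vecMulVec, vecMulVec_smul, smul_smul]
  have : 2 / (w ⬝ᵥ w) * (2 / (w ⬝ᵥ w)) * (w ⬝ᵥ w) = 2 / (w ⬝ᵥ w) + 2 / (w ⬝ᵥ w) := by
    field_simp; norm_num
  rw [← mul_assoc, this, add_smul]
  abel

theorem transpose_reflectionMatrix (w : Fin n → ℝ) :
    (reflectionMatrix w)ᵀ = reflectionMatrix w := by
  simp [reflectionMatrix, transpose_vecMulVec]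

theorem det_reflectionMatrix {w : Fin n → ℝ} (hw : w ≠ 0) : (reflectionMatrix w).det = -1 := by
  have h : w ⬝ᵥ w ≠ 0 := by simpa using hw
  have := det_one_add_replicateCol_mul_replicateRow (ι := Unit) (-(2 / (w ⬝ᵥ w)) • w) w
  rw [← vecMulVec_eq, smul_vecMulVec, dotProduct_smul, smul_eq_mul] at this
  rw [reflectionMatrix, sub_eq_add_neg, ← neg_smul, this]
  field_simp; norm_num

theorem reflectionMatrix_mul_mem {v w : Fin n → ℝ} (hv : v ≠ 0) (hw : w ≠ 0) :
    reflectionMatrix v * reflectionMatrix w ∈ specialOrthogonalGroup (Fin n) ℝ := by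
  have key : ∀ {w : Fin n → ℝ}, w ≠ 0 → reflectionMatrix w ∈ orthogonalGroup (Fin n) ℝ := by
    intro w hw
    rw [mem_orthogonalGroup_iff, transpose_reflectionMatrix, reflectionMatrix_mul_self hw]
  rw [mem_specialOrthogonalGroup_iff]
  exact ⟨mul_mem (key hv) (key hw), by
    rw [det_mul, det_reflectionMatrix hv, det_reflectionMatrix hw]; norm_num⟩

theorem analyticAt_reflectionMatrix_line (u d : Fin n → ℝ) {t : ℝ} (ht : u + t • d ≠ 0) :
    AnalyticAt ℝ (fun t : ℝ => reflectionMatrix (u + t • d)) t := by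
  have h : (u + t • d) ⬝ᵥ (u + t • d) ≠ 0 := fun h0 => ht (dotProduct_self_eq_zero.1 h0)
  have hv : (fun t : ℝ => vecMulVec (u + t • d) (u + t • d)) = fun t =>
      vecMulVec u u + t • (vecMulVec u d + vecMulVec d u) + (t * t) • vecMulVec d d := by
    funext t
    simp only [vecMulVec_add, add_vecMulVec, vecMulVec_smul, smul_vecMulVec, smul_add, smul_smul]
    abel
  have hd : (fun t : ℝ => (u + t • d) ⬝ᵥ (u + t • d)) = fun t =>
      u ⬝ᵥ u + t * (u ⬝ᵥ d + d ⬝ᵥ u) + (t * t) * (d ⬝ᵥ d) := by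
    funext t
    simp only [dotProduct_add, add_dotProduct, dotProduct_smul, smul_dotProduct, smul_eq_mul]
    ring
  have hd' : AnalyticAt ℝ (fun t : ℝ => (u + t • d) ⬝ᵥ (u + t • d)) t := by
    rw [hd]; fun_prop
  have hv' : AnalyticAt ℝ (fun t : ℝ => vecMulVec (u + t • d) (u + t • d)) t := by
    rw [hv]; fun_prop
  exact analyticAt_const.sub ((analyticAt_const.div hd' h).smul hv')

/-- Some analytic curve in `SO(n)` leads from `B` to the identity. -/
def JoinedToOneAnalytically (B : Matrix (Fin n) (Fin n) ℝ) : Prop :=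
  ∃ γ : ℝ → Matrix (Fin n) (Fin n) ℝ, AnalyticOnNhd ℝ γ Set.univ ∧
    (∀ t, γ t ∈ specialOrthogonalGroup (Fin n) ℝ) ∧ γ 0 = B ∧ γ 1 = 1

theorem joinedToOneAnalytically_one :
    JoinedToOneAnalytically (1 : Matrix (Fin n) (Fin n) ℝ) :=
  ⟨fun _ => 1, analyticOnNhd_const, fun _ => one_mem _, rfl, rfl⟩

theorem JoinedToOneAnalytically.mul {B C : Matrix (Fin n) (Fin n) ℝ}
    (hB : JoinedToOneAnalytically B) (hC : JoinedToOneAnalytically C) :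
    JoinedToOneAnalytically (B * C) := by
  obtain ⟨β, h1, h2, rfl, h4⟩ := hB
  obtain ⟨γ, k1, k2, rfl, k4⟩ := hC
  exact ⟨fun t => β t * γ t, h1.mul k1, fun t => mul_mem (h2 t) (k2 t), rfl, by simp [h4, k4]⟩

/-- Move the first mirror vector along the line to the second one. The line misses the origin,
unless the two vectors are proportional; then the product is already the identity. -/
theorem joinedToOneAnalytically_reflectionMatrix_mul {u v : Fin n → ℝ} (hu : u ≠ 0) (hv : v ≠ 0) :
    JoinedToOneAnalytically (reflectionMatrix u * reflectionMatrix v) := by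
  by_cases h : ∃ t : ℝ, u + t • (v - u) = 0
  · obtain ⟨t, ht⟩ := h
    have ht0 : t ≠ 0 := by
      rintro rfl
      exact hu (by simpa using ht)
    have ht1 : t - 1 ≠ 0 := by
      intro h1
      rw [sub_eq_zero.1 h1] at ht
      exact hv (by simpa using ht)
    have hvu : t • v = (t - 1) • u := by
      rw [← sub_eq_zero, ← ht]
      module
    rw [← reflectionMatrix_smul ht0 v, hvu, reflectionMatrix_smul ht1,
      reflectionMatrix_mul_self hu]
    exact joinedToOneAnalytically_one
  · push Not at h
    refine ⟨fun t => reflectionMatrix (u + t • (v - u)) * reflectionMatrix v, fun t _ =>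
      (analyticAt_reflectionMatrix_line u _ (h t)).mul analyticAt_const, fun t =>
      reflectionMatrix_mul_mem (h t) hv, by simp, ?_⟩
    simp [reflectionMatrix_mul_self hv]

theorem toEuclideanCLM_reflectionMatrix (w : EuclideanSpace ℝ (Fin n)) :
    toEuclideanCLM (𝕜 := ℝ) (reflectionMatrix w.ofLp) =
      ((Submodule.reflection (ℝ ∙ w)ᗮ : EuclideanSpace ℝ (Fin n) ≃ₗᵢ[ℝ] EuclideanSpace ℝ (Fin n)) :
        EuclideanSpace ℝ (Fin n) →L[ℝ] EuclideanSpace ℝ (Fin n)) := by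
  ext x i
  have h : inner ℝ w x = w.ofLp ⬝ᵥ x.ofLp := by
    simp [PiLp.inner_apply, dotProduct, mul_comm]
  have h' : ‖w‖ ^ 2 = w.ofLp ⬝ᵥ w.ofLp := by
    rw [EuclideanSpace.real_norm_sq_eq]
    simp only [dotProduct, sq]
  have := Submodule.reflection_orthogonal_apply (ℝ ∙ w) x
  rw [Submodule.reflection_singleton_apply] at this
  simp only [RCLike.ofReal_real_eq_id, id, h, h'] at this
  simp [this, reflectionMatrix, vecMulVec_mulVec]
  ring

/-- The Cartan–Dieudonné theorem, for matrices. -/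
theorem exists_list_reflectionMatrix {B : Matrix (Fin n) (Fin n) ℝ}
    (hB : B ∈ orthogonalGroup (Fin n) ℝ) :
    ∃ l : List (Fin n → ℝ), (∀ w ∈ l, w ≠ 0) ∧ B = (l.map reflectionMatrix).prod := by
  have hU : toEuclideanCLM (𝕜 := ℝ) B ∈ unitary _ := Unitary.map_mem _ hB
  obtain ⟨l, -, hl⟩ := (Unitary.linearIsometryEquiv ⟨_, hU⟩).reflections_generate_dim
  have key : B = ((l.map WithLp.ofLp).map reflectionMatrix).prod := by
    apply EquivLike.injective (toEuclideanCLM (n := Fin n) (𝕜 := ℝ))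
    have h2 := congrArg (fun e => ((Unitary.linearIsometryEquiv.symm e :
      unitary (EuclideanSpace ℝ (Fin n) →L[ℝ] EuclideanSpace ℝ (Fin n))) :
        EuclideanSpace ℝ (Fin n) →L[ℝ] EuclideanSpace ℝ (Fin n))) hl
    simp only [MulEquiv.symm_apply_apply] at h2
    rw [h2, map_list_prod, map_list_prod, ← Submonoid.coe_subtype, map_list_prod]
    simp only [List.map_map]
    congr 1
    refine List.map_congr_left fun w _ => ?_
    simp [toEuclideanCLM_reflectionMatrix]
  classical
  -- the zero vectors in the list contribute identity factors
  have hdrop : ∀ l : List (Fin n → ℝ),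
      ((l.filter (· ≠ 0)).map reflectionMatrix).prod = (l.map reflectionMatrix).prod := by
    intro l
    induction l with
    | nil => rfl
    | cons w l ih =>
      by_cases hw : w = 0
      · rw [List.filter_cons_of_neg (by simpa using hw), ih]
        simp [hw, reflectionMatrix]
      · rw [List.filter_cons_of_pos (by simpa using hw), List.map_cons, List.prod_cons, ih,
          List.map_cons, List.prod_cons]
  exact ⟨(l.map WithLp.ofLp).filter (· ≠ 0), fun w hw => by simpa using (List.mem_filter.1 hw).2,
    key.trans (hdrop _).symm⟩

/-- The determinant makes the number of reflections even, so they can be taken in pairs. -/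
theorem joinedToOneAnalytically_prod_of_det_eq_one :
    ∀ l : List (Fin n → ℝ), (∀ w ∈ l, w ≠ 0) → (l.map reflectionMatrix).prod.det = 1 →
      JoinedToOneAnalytically (l.map reflectionMatrix).prod
  | [], _, _ => joinedToOneAnalytically_one
  | [w], hl, hd => by
    simp only [List.map_cons, List.map_nil, List.prod_singleton,
      det_reflectionMatrix (hl w (by simp))] at hd
    norm_num at hd
  | u :: v :: l, hl, hd => by
    have hu := hl u (by simp)
    have hv := hl v (by simp)
    simp only [List.map_cons, List.prod_cons, det_mul, det_reflectionMatrix hu,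
      det_reflectionMatrix hv] at hd
    simp only [List.map_cons, List.prod_cons, ← mul_assoc]
    exact (joinedToOneAnalytically_reflectionMatrix_mul hu hv).mul
      (joinedToOneAnalytically_prod_of_det_eq_one l (fun w hw => hl w (by simp [hw]))
        (by simpa using hd))

theorem Matrix.specialOrthogonalGroup_subset_closure_det_ne_zero (n : ℕ) :
    (specialOrthogonalGroup (Fin n) ℝ : Set (Matrix (Fin n) (Fin n) ℝ)) ⊆
      closure {C ∈ (specialOrthogonalGroup (Fin n) ℝ : Set (Matrix (Fin n) (Fin n) ℝ)) |
        (1 + C).det ≠ 0} := by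
  intro B hB
  obtain ⟨hO, hd⟩ := mem_specialOrthogonalGroup_iff.1 hB
  obtain ⟨l, hl, rfl⟩ := exists_list_reflectionMatrix hO
  obtain ⟨γ, h1, h2, h3, h4⟩ := joinedToOneAnalytically_prod_of_det_eq_one l hl hd
  rw [← h3]
  refine mem_closure_of_analytic_curve h1 h2 (t₁ := 1) ?_ 0
  rw [h4, show (1 + 1 : Matrix (Fin n) (Fin n) ℝ) = (2 : ℝ) • 1 by rw [two_smul], det_smul]
  simp

end Reflections

/-! ### Pulling the logarithm back to a real form -/

section RealForm

open scoped Real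

variable {M 𝒜 : Type*} [NormedRing M] [NormedAlgebra ℝ M] [FiniteDimensional ℝ M]
  [StarRing M] [StarModule ℝ M] [CStarAlgebra 𝒜] [FiniteDimensional ℝ 𝒜]

/-- For a real ⋆-algebra `M` embedded by `ι` in a C⋆-algebra, and a set `G` of unitary elements of
`M` containing the exponentials of the skew-adjoint ones, `V` is the set of those `A` for which
`ι A` has norm less than `π`. By `hlog` its image under `exp` is `{B ∈ G | ‖ι B - 1‖ < 2}`, and
the inverse there is `logUnitary` carried back to `M` by a linear left inverse of `ι`. -/
theorem exists_isBianalyticOn_exp (ι : M →⋆ₐ[ℝ] 𝒜) (hι : Function.Injective ι) {G : Set M}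
    (hG : G ⊆ (unitary M : Set M)) (hexp : ∀ A ∈ skewAdjoint M, NormedSpace.exp A ∈ G)
    (hlog : ∀ B ∈ G, ‖ι B - 1‖ < 2 → logUnitary (ι B) ∈ Set.range ι)
    (hdense : G ⊆ closure {B ∈ G | ‖ι B - 1‖ < 2}) :
    ∃ V : Set (skewAdjoint.submodule ℝ M),
      IsOpen V ∧ Bornology.IsBounded V ∧ 0 ∈ V ∧
      IsBianalyticOn (fun A : skewAdjoint.submodule ℝ M => NormedSpace.exp (A : M)) G V ∧
      G ⊆ closure ((fun A : skewAdjoint.submodule ℝ M => NormedSpace.exp (A : M)) '' V) := by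
  let +nondep : NormedAlgebra ℚ M := .restrictScalars ℚ ℝ M
  let +nondep : NormedAlgebra ℚ 𝒜 := .restrictScalars ℚ ℝ 𝒜
  have : CompleteSpace M := FiniteDimensional.complete ℝ M
  let ιL : M →L[ℝ] 𝒜 := LinearMap.toContinuousLinearMap (ι : M →ₗ[ℝ] 𝒜)
  have hcont : Continuous ι := ιL.continuous
  let j : skewAdjoint.submodule ℝ M →ₗ[ℝ] 𝒜 :=
    (ι : M →ₗ[ℝ] 𝒜) ∘ₗ (skewAdjoint.submodule ℝ M).subtype
  have hj : ∀ A, j A = ι (A : M) := fun _ => rfl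
  have hjinj : Function.Injective j := hι.comp Subtype.val_injective
  have hjcont : Continuous j := hcont.comp continuous_subtype_val
  -- `logUnitary` takes values in `𝒜`; `p` brings those in the range of `j` back to `M`
  obtain ⟨p, hp⟩ := j.exists_leftInverse_of_injective (LinearMap.ker_eq_bot.2 hjinj)
  have hp' : ∀ A, p (j A) = A := fun A => congrArg (· A) hp
  have hskew : ∀ A : skewAdjoint.submodule ℝ M, j A ∈ skewAdjoint 𝒜 := by
    intro A
    rw [skewAdjoint.mem_iff, hj, ← map_star, skewAdjoint.mem_iff.1 A.2, map_neg]
  have hexpj : ∀ A : skewAdjoint.submodule ℝ M,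
      ι (NormedSpace.exp (A : M)) = NormedSpace.exp (j A) := fun A =>
    NormedSpace.map_exp ι hcont (A : M)
  have hunit : ∀ {B}, B ∈ G → ι B ∈ unitary 𝒜 := fun h => Unitary.map_mem ι (hG h)
  let V : Set (skewAdjoint.submodule ℝ M) := {A | ‖j A‖ < π}
  have himage : (fun A : skewAdjoint.submodule ℝ M => NormedSpace.exp (A : M)) '' V =
      {B ∈ G | ‖ι B - 1‖ < 2} := by
    apply Set.Subset.antisymm
    · rintro _ ⟨A, hA, rfl⟩
      exact ⟨hexp _ A.2, by rw [hexpj]; exact norm_exp_sub_one_lt_two (hskew A) hA⟩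
    · rintro B ⟨hB, h2⟩
      obtain ⟨A, hA⟩ := hlog B hB h2
      have hAs : A ∈ skewAdjoint.submodule ℝ M := by
        change A ∈ skewAdjoint M
        rw [skewAdjoint.mem_iff]
        apply hι
        rw [map_star, hA, skewAdjoint.mem_iff.1 (logUnitary_mem_skewAdjoint _), map_neg, hA]
      refine ⟨⟨A, hAs⟩, ?_, hι ?_⟩
      · change ‖ι A‖ < π
        rw [hA]
        exact norm_logUnitary_lt_pi (hunit hB) h2
      · change ι (NormedSpace.exp A) = _
        rw [NormedSpace.map_exp ι hcont, hA, exp_logUnitary (hunit hB) h2]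
  refine ⟨V, isOpen_lt hjcont.norm continuous_const, ?_, by simp [V, Real.pi_pos], ?_, ?_⟩
  · obtain ⟨K, -, hK⟩ := j.exists_antilipschitzWith (LinearMap.ker_eq_bot.2 hjinj)
    refine (hK.isBounded_preimage (Metric.isBounded_ball (x := 0) (r := π))).subset ?_
    intro A hA
    simpa [V] using hA
  · refine ⟨fun A _ => hexp _ A.2, fun A _ => ?_, ⟨{B | ‖ι B - 1‖ < 2}, ?_, ?_⟩,
      fun B => p (logUnitary (ι B)), fun A hA => ?_, ?_⟩
    · exact (NormedSpace.exp_analytic (𝕂 := ℝ) (A : M)).comp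
        ((skewAdjoint.submodule ℝ M).subtypeL.analyticAt A)
    · exact isOpen_lt (by fun_prop) continuous_const
    · rw [himage]
      ext B
      exact and_comm
    · change p (logUnitary (ι (NormedSpace.exp (A : M)))) = A
      rw [hexpj, logUnitary_exp (hskew A) hA, hp']
    · rw [himage]
      exact (LinearMap.toContinuousLinearMap p).comp_analyticOn
        (analyticOn_logUnitary.comp (ιL.analyticOn _) fun B hB => ⟨hunit hB.1, hB.2⟩)
  · rw [himage]
    exact hdense

end RealForm

/-! ### The orthogonal and unitary groups -/

section Matrix

open Matrix

variable {n : ℕ}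

/-- Instance search does not see that these operators, finite-dimensional over `ℂ`, are also
finite-dimensional over `ℝ`. -/
instance finiteDimensional_real_euclideanCLM :
    FiniteDimensional ℝ (EuclideanSpace ℂ (Fin n) →L[ℂ] EuclideanSpace ℂ (Fin n)) :=
  FiniteDimensional.complexToReal _

/-- A unitary element at distance `2` from `1` has `-1` in its spectrum, and for a matrix `B` that
makes `1 + B` singular. -/
theorem norm_toEuclideanCLM_sub_one_lt_two {B : Matrix (Fin n) (Fin n) ℂ}
    (hB : B ∈ unitaryGroup (Fin n) ℂ) (hd : (1 + B).det ≠ 0) :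
    ‖toEuclideanCLM (𝕜 := ℂ) B - 1‖ < 2 := by
  rw [Unitary.norm_sub_one_lt_two_iff (Unitary.map_mem _ hB), AlgEquiv.spectrum_eq,
    spectrum.notMem_iff]
  have : algebraMap ℂ (Matrix (Fin n) (Fin n) ℂ) (-1) - B = -(1 + B) := by
    rw [map_neg, map_one]; abel
  rw [this, IsUnit.neg_iff, isUnit_iff_isUnit_det]
  exact hd.isUnit

theorem norm_toEuclideanCLM_map_star_le (A : Matrix (Fin n) (Fin n) ℂ) :
    ‖toEuclideanCLM (𝕜 := ℂ) (A.map star)‖ ≤ ‖toEuclideanCLM (𝕜 := ℂ) A‖ := by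
  refine ContinuousLinearMap.opNorm_le_bound _ (norm_nonneg _) fun x => ?_
  have hs : ∀ y : Fin n → ℂ, ‖WithLp.toLp 2 (star y)‖ = ‖WithLp.toLp 2 y‖ := by
    intro y
    simp [EuclideanSpace.norm_eq]
  have h := (toEuclideanCLM (𝕜 := ℂ) A).le_opNorm (WithLp.toLp 2 (star x.ofLp))
  rw [hs, toEuclideanCLM_toLp] at h
  have he : toEuclideanCLM (𝕜 := ℂ) (A.map star) x =
      WithLp.toLp 2 (star (A *ᵥ star x.ofLp)) := by
    ext i
    simp [mulVec, dotProduct]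
  rw [he, hs]
  exact h

/-- Complex matrices as operators on the complex Euclidean space, with real scalars only. -/
noncomputable def complexMatrixToEuclideanCLM (n : ℕ) :
    Matrix (Fin n) (Fin n) ℂ →⋆ₐ[ℝ] (EuclideanSpace ℂ (Fin n) →L[ℂ] EuclideanSpace ℂ (Fin n)) where
  toAlgHom := (toEuclideanCLM (n := Fin n) (𝕜 := ℂ)).toAlgEquiv.toAlgHom.restrictScalars ℝ
  map_star' A := map_star (toEuclideanCLM (n := Fin n) (𝕜 := ℂ)) A

/-- Real matrices as operators on the complex Euclidean space. -/
noncomputable def realMatrixToEuclideanCLM (n : ℕ) :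
    Matrix (Fin n) (Fin n) ℝ →⋆ₐ[ℝ] (EuclideanSpace ℂ (Fin n) →L[ℂ] EuclideanSpace ℂ (Fin n)) where
  toAlgHom := (complexMatrixToEuclideanCLM n).toAlgHom.comp Complex.ofRealAm.mapMatrix
  map_star' A := by
    change toEuclideanCLM (𝕜 := ℂ) ((star A).map _) = star (toEuclideanCLM (𝕜 := ℂ) (A.map _))
    rw [← map_star]
    congr 1
    ext i j
    simp

theorem realMatrixToEuclideanCLM_apply (A : Matrix (Fin n) (Fin n) ℝ) :
    realMatrixToEuclideanCLM n A = toEuclideanCLM (𝕜 := ℂ) (A.map Complex.ofReal) := rfl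

theorem realMatrixToEuclideanCLM_injective : Function.Injective (realMatrixToEuclideanCLM n) := by
  intro A B h
  have h := (toEuclideanCLM (n := Fin n) (𝕜 := ℂ)).injective h
  ext i j
  exact Complex.ofReal_injective (congrFun (congrFun h i) j)

theorem norm_realMatrixToEuclideanCLM_sub_one_lt_two {B : Matrix (Fin n) (Fin n) ℝ}
    (hB : B ∈ orthogonalGroup (Fin n) ℝ) (hd : (1 + B).det ≠ 0) :
    ‖realMatrixToEuclideanCLM n B - 1‖ < 2 := by
  refine norm_toEuclideanCLM_sub_one_lt_two (B := B.map Complex.ofReal) ?_ ?_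
  · have h := congrArg (Complex.ofRealHom.mapMatrix) ((mem_orthogonalGroup_iff _ _).1 hB)
    rw [map_mul, map_one] at h
    rw [mem_unitaryGroup_iff, ← h]
    congr 1
    ext i j
    simp
  · have h := Complex.ofRealHom.map_det (1 + B)
    rw [map_add, map_one] at h
    exact h ▸ Complex.ofReal_ne_zero.2 hd

theorem exp_mem_specialOrthogonalGroup {A : Matrix (Fin n) (Fin n) ℝ} (hA : A ∈ skewAdjoint _) :
    NormedSpace.exp A ∈ specialOrthogonalGroup (Fin n) ℝ := by
  let +nondep : NormedAlgebra ℚ (Matrix (Fin n) (Fin n) ℝ) := .restrictScalars ℚ ℝ _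
  have key : ∀ {C : Matrix (Fin n) (Fin n) ℝ}, C ∈ skewAdjoint _ →
      NormedSpace.exp C ∈ orthogonalGroup (Fin n) ℝ := fun hC =>
    NormedSpace.exp_mem_unitary_of_mem_skewAdjoint hC
  refine mem_specialOrthogonalGroup_iff.2 ⟨key hA, ?_⟩
  -- `exp A` is the square of the orthogonal matrix `exp (A / 2)`, whose determinant is `±1`
  have hh : (2⁻¹ : ℝ) • A ∈ skewAdjoint (Matrix (Fin n) (Fin n) ℝ) := skewAdjoint.smul_mem _ hA
  have h1 := congrArg det ((mem_orthogonalGroup_iff _ _).1 (key hh))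
  rw [det_mul, det_transpose,
    det_one, ← det_mul] at h1
  have h2 : NormedSpace.exp A =
      NormedSpace.exp ((2⁻¹ : ℝ) • A) * NormedSpace.exp ((2⁻¹ : ℝ) • A) := by
    refine Eq.trans ?_ (NormedSpace.exp_add_of_commute (Commute.refl ((2⁻¹ : ℝ) • A)))
    rw [← add_smul, show (2⁻¹ + 2⁻¹ : ℝ) = 1 by norm_num, one_smul]
    rfl
  rw [h2, h1]

/-- The principal logarithm of a real matrix is real, since it is the only logarithm of norm less
than `π`, and so agrees with its complex conjugate. -/
theorem logUnitary_mem_range_realMatrixToEuclideanCLM {B : Matrix (Fin n) (Fin n) ℝ}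
    (hB : B ∈ orthogonalGroup (Fin n) ℝ) (h2 : ‖realMatrixToEuclideanCLM n B - 1‖ < 2) :
    logUnitary (realMatrixToEuclideanCLM n B) ∈ Set.range (realMatrixToEuclideanCLM n) := by
  let +nondep : NormedAlgebra ℚ (Matrix (Fin n) (Fin n) ℂ) := .restrictScalars ℚ ℝ _
  have hU : realMatrixToEuclideanCLM n B ∈ unitary _ := Unitary.map_mem _ hB
  let e := toEuclideanCLM (n := Fin n) (𝕜 := ℂ)
  have he : Continuous e := LinearMap.continuous_of_finiteDimensional
    (e.toAlgEquiv.toLinearMap : Matrix (Fin n) (Fin n) ℂ →ₗ[ℂ] _)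
  have hexpe : ∀ Z, e (NormedSpace.exp Z) = NormedSpace.exp (e Z) := NormedSpace.map_exp e he
  have hinj : Function.Injective e := EquivLike.injective e
  obtain ⟨X, hX⟩ := EquivLike.surjective e (logUnitary (realMatrixToEuclideanCLM n B))
  have hπ : ‖e X‖ < Real.pi := hX ▸ norm_logUnitary_lt_pi hU h2
  have hexpX : NormedSpace.exp X = B.map Complex.ofReal := by
    apply hinj
    rw [hexpe, hX, exp_logUnitary hU h2]
    rfl
  have hXs : star X = -X := by
    apply hinj
    rw [map_star, hX, skewAdjoint.mem_iff.1 (logUnitary_mem_skewAdjoint _), map_neg, hX]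
  -- the complex conjugate `Y` of the logarithm `X` is a logarithm of the same real matrix
  let Y : Matrix (Fin n) (Fin n) ℂ := X.map star
  have hYs : e Y ∈ skewAdjoint _ := by
    rw [skewAdjoint.mem_iff, ← map_star, ← map_neg]
    congr 1
    ext i j
    have h : star (X i j) = -X j i := congrFun (congrFun hXs j) i
    change star (star (X j i)) = -star (X i j)
    rw [h, star_star, neg_neg]
  have hexpY : NormedSpace.exp Y = B.map Complex.ofReal := by
    have hc : Continuous ((starRingEnd ℂ).mapMatrix : Matrix (Fin n) (Fin n) ℂ →+* _) :=
      continuous_id.matrix_map Complex.continuous_conj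
    have h : (starRingEnd ℂ).mapMatrix (NormedSpace.exp X) = NormedSpace.exp Y :=
      NormedSpace.map_exp ((starRingEnd ℂ).mapMatrix : Matrix (Fin n) (Fin n) ℂ →+* _) hc X
    rw [← h, hexpX]
    ext i j
    simp
  have hXY : Y = X := by
    apply hinj
    rw [← logUnitary_exp hYs ((norm_toEuclideanCLM_map_star_le X).trans_lt hπ),
      ← hexpe, hexpY, hX]
    rfl
  refine ⟨X.map Complex.re, ?_⟩
  rw [← hX, realMatrixToEuclideanCLM_apply]
  refine congrArg e ?_
  ext i j
  exact Complex.conj_eq_iff_re.1 (congrFun (congrFun hXY i) j)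

end Matrix

theorem mainTheorem3 (n : ℕ) :
    (∃ V : Set (soAlgebra n),
      IsOpen V ∧ Bornology.IsBounded V ∧ 0 ∈ V ∧
      IsBianalyticOn
        (fun A : soAlgebra n => NormedSpace.exp (A : Matrix (Fin n) (Fin n) ℝ))
        (Matrix.specialOrthogonalGroup (Fin n) ℝ : Set (Matrix (Fin n) (Fin n) ℝ)) V ∧
      (Matrix.specialOrthogonalGroup (Fin n) ℝ : Set (Matrix (Fin n) (Fin n) ℝ)) ⊆
        closure ((fun A : soAlgebra n =>
          NormedSpace.exp (A : Matrix (Fin n) (Fin n) ℝ)) '' V)) ∧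
    (∃ V : Set (uAlgebra n),
      IsOpen V ∧ Bornology.IsBounded V ∧ 0 ∈ V ∧
      IsBianalyticOn
        (fun A : uAlgebra n => NormedSpace.exp (A : Matrix (Fin n) (Fin n) ℂ))
        (Matrix.unitaryGroup (Fin n) ℂ : Set (Matrix (Fin n) (Fin n) ℂ)) V ∧
      (Matrix.unitaryGroup (Fin n) ℂ : Set (Matrix (Fin n) (Fin n) ℂ)) ⊆
        closure ((fun A : uAlgebra n =>
          NormedSpace.exp (A : Matrix (Fin n) (Fin n) ℂ)) '' V)) := by
  refine ⟨?_, ?_⟩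
  · exact exists_isBianalyticOn_exp (realMatrixToEuclideanCLM n)
      realMatrixToEuclideanCLM_injective (fun B hB => hB.1)
      (fun A hA => exp_mem_specialOrthogonalGroup hA)
      (fun B hB h2 => logUnitary_mem_range_realMatrixToEuclideanCLM hB.1 h2)
      ((Matrix.specialOrthogonalGroup_subset_closure_det_ne_zero n).trans
        (closure_mono fun B hB =>
          ⟨hB.1, norm_realMatrixToEuclideanCLM_sub_one_lt_two hB.1.1 hB.2⟩))
  · let +nondep : NormedAlgebra ℚ (Matrix (Fin n) (Fin n) ℂ) := .restrictScalars ℚ ℝ _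
    exact exists_isBianalyticOn_exp (complexMatrixToEuclideanCLM n)
      (EquivLike.injective (Matrix.toEuclideanCLM (n := Fin n) (𝕜 := ℂ))) subset_rfl
      (fun A hA => NormedSpace.exp_mem_unitary_of_mem_skewAdjoint hA)
      (fun B _ _ => EquivLike.surjective (Matrix.toEuclideanCLM (n := Fin n) (𝕜 := ℂ)) _)
      ((Matrix.unitaryGroup_subset_closure_det_ne_zero n).trans
        (closure_mono fun B hB => ⟨hB.1, norm_toEuclideanCLM_sub_one_lt_two hB.1 hB.2⟩))
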